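/- **Setting.** Let $\mathcal Y,\mathcal Z$ be countable alphabets, and for $x\in\{0,1\}$ (channel input; $0$ innocent, $1$ probing) and $\theta\in\{0,1\}$ (channel state) let $W(\cdot,\cdot\mid x,\theta)$ be a probability mass function on $\mathcal Y\times\mathcal Z$, with marginals $P^x_\theta$ on $\mathcal Y$ and $Q^x_\theta$ on $\mathcal Z$. Put $\chi_{2,\theta}=\sum_z (Q^1_\theta(z)-Q^0_\theta(z))^2/Q^0_\theta(z)$ and $D=\sum_y P^1_1(y)\ln\frac{P^1_1(y)}{P^1_0(y)}$. Assume $Q^1_\theta\ll Q^0_\theta$ and $Q^1_\theta\neq Q^0_\theta$ for $\theta=0,1$; $P^0_1=P^0_0$; $0<D<\infty$; and $\sum_y P^1_1(y)\bigl(\ln\frac{P^1_1(y)}{P^1_0(y)}\bigr)^2<\infty$. Let $\rho\in(0,1)$ and $d=|\ln(1-\rho)|$. The changepoint $\Gamma$ satisfies $\mathbb P(\Gamma=k)=\rho(1-\rho)^{k-1}$, $k\ge 1$. A causal policy $\Pi=(\tau,\beta)$ consists of functions $\beta_t$ of $(X^{t-1},Y^{t-1})$ with values in $[0,1]$ and tests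 $d_t$ of $(X^{t-1},Y^{t-1})$ with values in $\{0,1\}$, $t\ge1$, where $d_1\equiv0$; $\tau=\inf\{t: d_t(X^{t-1},Y^{t-1})=1\}\in\mathbb N\cup\{\infty\}$, and $\beta_t=0$ for all $t\ge\tau$. Given $\Gamma$ and $(X^{t-1},Y^{t-1},Z^{t-1})$, one has $X_t\sim\mathrm{Ber}(\beta_t(X^{t-1},Y^{t-1}))$ and then $(Y_t,Z_t)\sim W(\cdot,\cdot\mid X_t,\mathbb I\{t>\Gamma\})$. The policy is innocent if $\beta\equiv 0$. Define $$\mathrm{ADD}(\Pi)=\mathbb E[(\tau-\Gamma)^+],\qquad \mathrm{PFA}(\Pi)=\mathbb P(\tau<\Gamma),\qquad \mathrm{ECB}(\Pi)=\mathbb E\Bigl[\sum_{i=1}^{\tau}\chi_{2,\mathbb I\{i>\Gamma\}}\,\beta_i(X^{i-1},Y^{i-1})^2\Bigr],$$ let $\mathrm{ADD}^\star(\alpha,\delta)$ be the infimum of $\mathrm{ADD}(\Pi)$ over all causal policies with $\mathrm{PFA}(\Pi)\le\alpha$ and $\mathrm{ECB}(\Pi)\le\delta$, and let $\mathrm{ADD}^{0}(\alpha)$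 be the infimum of $\mathrm{ADD}(\Pi)$ over all innocent policies with $\mathrm{PFA}(\Pi)\le\alpha$. **Theorem (Maximum Covert Sensing Gain).** Fix $\delta>0$ and put $\kappa=\dfrac{D\sqrt\delta}{d^{3/2}\sqrt{\chi_{2,1}}}$ (read as $0$ if $\chi_{2,1}=\infty$). 1. There are constants $C\in\mathbb R$ and $\alpha_0\in(0,1)$ such that for all $\alpha\in(0,\alpha_0)$ every causal policy $\Pi$ with $\mathrm{PFA}(\Pi)\le\alpha$ and $\mathrm{ECB}(\Pi)\le\delta$ satisfies $$\mathrm{ADD}(\Pi)\ \ge\ \frac{|\ln\alpha|}{d}-\kappa\sqrt{|\ln\alpha|}-C .$$ 2. Covert probing cannot improve the first-order delay: $\mathrm{ADD}^\star(\alpha,\delta)/|\ln\alpha|\to 1/d$ as $\alpha\to0^+$. 3. It gains at most a square-root-order term: there are constants $C\in\mathbb R$ and $\alpha_0\in(0,1)$ such that $\mathrm{ADD}^{0}(\alpha)\le \mathrm{ADD}^\star(\alpha,\delta)+\kappa\sqrt{|\ln\alpha|}+C$ for all $\alpha\in(0,\alpha_0)$. -/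

import Mathlib

open Filter Topology MeasureTheory ProbabilityTheory
open scoped ENNReal

namespace CovertQCD

universe u v

/-- A memoryless channel with input `x : Bool` (`false`: innocent action `0`, `true`: active probe
`1`), state `θ : Bool` (`false`: pre-change `0`, `true`: post-change `1`), and a pair of outputs
`(y, z)`, the first received by Alice and the second by Eve; `W x θ` is the PMF
`W_{Y,Z|X,θ}(·, · | x, θ)`. -/
abbrev Channel (Y : Type u) (Z : Type v) := Bool → Bool → PMF (Y × Z)

/-- Alice's observation channel `P^x_θ`. -/
noncomputable def aliceChannel {Y : Type u} {Z : Type v} (W : Channel Y Z) (x θ : Bool) : PMF Y :=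
  (W x θ).map Prod.fst

/-- Eve's observation channel `Q^x_θ`. -/
noncomputable def eveChannel {Y : Type u} {Z : Type v} (W : Channel Y Z) (x θ : Bool) : PMF Z :=
  (W x θ).map Prod.snd

/-- `χ₂(P‖Q) = ∑_z (P(z) - Q(z))² / Q(z)`, for PMFs with `P ≪ Q`; the value `∞` is allowed.
When `Q(z) = 0` one also has `P(z) = 0`, and the term is `0`. -/
noncomputable def chi2 {Z : Type v} (P Q : PMF Z) : ℝ≥0∞ :=
  ∑' z, ENNReal.ofReal (((P z).toReal - (Q z).toReal) ^ 2 / (Q z).toReal)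

/-- `χ_{2,θ} = χ₂(Q^1_θ ‖ Q^0_θ)`. -/
noncomputable def eveChi2 {Y : Type u} {Z : Type v} (W : Channel Y Z) (θ : Bool) : ℝ≥0∞ :=
  chi2 (eveChannel W true θ) (eveChannel W false θ)

/-- `D = 𝔻(P^1_1 ‖ P^1_0)`. -/
noncomputable def activeDiv {Y : Type u} {Z : Type v} [MeasurableSpace Y] (W : Channel Y Z) :
    ℝ≥0∞ :=
  InformationTheory.klDiv (aliceChannel W true true).toMeasure
    (aliceChannel W true false).toMeasure

/-- `𝕍(P‖Q) = 𝔼_{Y ∼ P}[(ln (P(Y)/Q(Y)))²]`, for PMFs with `P ≪ Q`. -/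
noncomputable def llrSecondMoment {Y : Type u} (P Q : PMF Y) : ℝ≥0∞ :=
  ∑' y, P y * ENNReal.ofReal (Real.log ((P y).toReal / (Q y).toReal) ^ 2)

/-- A causal policy `(τ, β)` of Alice. A function indexed by `n` is used at time `t = n + 1`, when
the history `(X^{t-1}, Y^{t-1})` has length `n`: `probe n` is the sensing probability `β_{n+1}` and
`halt n` is the stopping test `d_{n+1}`. Alice does not stop without data (`d_1 ≡ 0`), and she
sends only the innocent symbol from the stopping time on (`β_t = 0` for all `t ≥ τ`). -/
structure Policy (Y : Type u) where
  probe : (n : ℕ) → (Fin n → Bool × Y) → ℝ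
  halt : (n : ℕ) → (Fin n → Bool × Y) → Bool
  probe_mem : ∀ n h, probe n h ∈ Set.Icc (0 : ℝ) 1
  halt_zero : ∀ h, halt 0 h = false
  probe_eq_zero : ∀ n h,
    (∃ (m : ℕ) (hm : m ≤ n), halt m (fun i => h (Fin.castLE hm i)) = true) → probe n h = 0

/-- An innocent policy never probes: `β ≡ 0`. -/
def Policy.IsInnocent {Y : Type u} (p : Policy Y) : Prop := ∀ n h, p.probe n h = 0

/-- A sample path: `ω n = (X_t, Y_t, Z_t)` with `t = n + 1`. -/
abbrev Path (Y : Type u) (Z : Type v) := ℕ → Bool × Y × Z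

/-- Alice's history `(X^n, Y^n)` after the first `n` time steps. -/
def history {Y : Type u} {Z : Type v} (ω : Path Y Z) (n : ℕ) : Fin n → Bool × Y :=
  fun i => ((ω i).1, (ω i).2.1)

/-- The channel state `θ_t(k) = 𝕀{t > k}`, when the changepoint is `k`. -/
def state (k t : ℕ) : Bool := decide (k < t)

/-- The joint law of `(X_t, Y_t, Z_t)` when `X_t ∼ Ber(b)` and the channel is in state `θ`. -/
noncomputable def stepLaw {Y : Type u} {Z : Type v} [MeasurableSpace Y] [MeasurableSpace Z]
    (W : Channel Y Z) (θ : Bool) (b : ℝ) : Measure (Bool × Y × Z) :=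
  ENNReal.ofReal b • (W true θ).toMeasure.map (Prod.mk true)
    + ENNReal.ofReal (1 - b) • (W false θ).toMeasure.map (Prod.mk false)

theorem stepLaw_isProbabilityMeasure {Y : Type u} {Z : Type v} [MeasurableSpace Y]
    [MeasurableSpace Z] (W : Channel Y Z) (θ : Bool) (b : ℝ) (hb : b ∈ Set.Icc (0 : ℝ) 1) :
    IsProbabilityMeasure (stepLaw W θ b) := by
  constructor
  have h : ∀ x : Bool, (W x θ).toMeasure.map (Prod.mk x) Set.univ = 1 := fun x => by
    rw [Measure.map_apply measurable_prodMk_left MeasurableSet.univ, Set.preimage_univ,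
      measure_univ]
  simp only [stepLaw, Measure.add_apply, Measure.smul_apply, h, smul_eq_mul, mul_one]
  rw [← ENNReal.ofReal_add hb.1 (sub_nonneg.2 hb.2)]
  simp

/-- The conditional law of `(X_t, Y_t, Z_t)`, `t = n + 2`, given the first `n + 1` time steps, when
Alice uses the policy `p` and the changepoint is `k`. -/
noncomputable def stepKernel {Y : Type u} {Z : Type v} [MeasurableSpace Y] [MeasurableSpace Z]
    [Countable Y] [Countable Z] [MeasurableSingletonClass Y] [MeasurableSingletonClass Z]
    (W : Channel Y Z) (p : Policy Y) (k n : ℕ) :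
    Kernel ((i : Finset.Iic n) → (fun _ : ℕ => Bool × Y × Z) i) (Bool × Y × Z) :=
  Kernel.ofFunOfCountable fun h =>
    stepLaw W (state k (n + 2))
      (p.probe (n + 1) fun i =>
        ((h ⟨i, Finset.mem_Iic.2 (Nat.lt_succ_iff.1 i.2)⟩).1,
          (h ⟨i, Finset.mem_Iic.2 (Nat.lt_succ_iff.1 i.2)⟩).2.1))

instance {Y : Type u} {Z : Type v} [MeasurableSpace Y] [MeasurableSpace Z]
    [Countable Y] [Countable Z] [MeasurableSingletonClass Y] [MeasurableSingletonClass Z]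
    (W : Channel Y Z) (p : Policy Y) (k n : ℕ) : IsMarkovKernel (stepKernel W p k n) :=
  ⟨fun _ => stepLaw_isProbabilityMeasure _ _ _ (p.probe_mem _ _)⟩

/-- `ℙ_k`: the law of the whole path `(X_t, Y_t, Z_t)_{t ≥ 1}` when Alice uses the policy `p` and
the changepoint is `k`. -/
noncomputable def pathLaw {Y : Type u} {Z : Type v} [MeasurableSpace Y] [MeasurableSpace Z]
    [Countable Y] [Countable Z] [MeasurableSingletonClass Y] [MeasurableSingletonClass Z]
    (W : Channel Y Z) (p : Policy Y) (k : ℕ) : Measure (Path Y Z) :=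
  Kernel.trajMeasure (X := fun _ : ℕ => Bool × Y × Z)
    (stepLaw W (state k 1) (p.probe 0 Fin.elim0)) (stepKernel W p k)

/-- The geometric prior `π_k = ρ (1 - ρ)^{k-1}`, `k ≥ 1`, of the changepoint. -/
noncomputable def prior (ρ : ℝ) (k : ℕ) : ℝ :=
  if k = 0 then 0 else ρ * (1 - ρ) ^ (k - 1)

/-- The exponent `d = |ln(1 - ρ)|` of the prior tail. -/
noncomputable def tailExp (ρ : ℝ) : ℝ := |Real.log (1 - ρ)|

/-- `ℙ_π`: the joint law of the changepoint `Γ` and the path, `∑_k π_k δ_k ⊗ ℙ_k`. -/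
noncomputable def bayesLaw {Y : Type u} {Z : Type v} [MeasurableSpace Y] [MeasurableSpace Z]
    [Countable Y] [Countable Z] [MeasurableSingletonClass Y] [MeasurableSingletonClass Z]
    (W : Channel Y Z) (ρ : ℝ) (p : Policy Y) : Measure (ℕ × Path Y Z) :=
  Measure.sum fun k => ENNReal.ofReal (prior ρ k) • (pathLaw W p k).map (Prod.mk k)

/-- The stopping time `τ = inf {t ≥ 1 : d_t(X^{t-1}, Y^{t-1}) = 1}`, with `inf ∅ = ∞`. -/
noncomputable def stopTime {Y : Type u} {Z : Type v} (p : Policy Y) (ω : Path Y Z) : ℕ∞ :=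
  ⨅ (n : ℕ) (_ : p.halt n (history ω n) = true), ((n + 1 : ℕ) : ℕ∞)

section metrics

variable {Y : Type u} {Z : Type v} [MeasurableSpace Y] [MeasurableSpace Z]
  [Countable Y] [Countable Z] [MeasurableSingletonClass Y] [MeasurableSingletonClass Z]

/-- The average detection delay `𝔼[(τ - Γ)⁺]`; subtraction in `ℕ∞` is truncated at `0`. -/
noncomputable def ADD (W : Channel Y Z) (ρ : ℝ) (p : Policy Y) : ℝ≥0∞ :=
  ∫⁻ q, ((stopTime p q.2 - (q.1 : ℕ∞) : ℕ∞) : ℝ≥0∞) ∂bayesLaw W ρ p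

/-- The probability of false alarm `ℙ{τ < Γ}`. -/
noncomputable def PFA (W : Channel Y Z) (ρ : ℝ) (p : Policy Y) : ℝ≥0∞ :=
  bayesLaw W ρ p {q | stopTime p q.2 < (q.1 : ℕ∞)}

open Classical in
/-- The expected covertness budget
`𝔼[∑_{i=1}^τ χ₂(Q^1_{𝕀{i>Γ}} ‖ Q^0_{𝕀{i>Γ}}) β_i(X^{i-1}, Y^{i-1})²]`, where `i = n + 1`. -/
noncomputable def ECB (W : Channel Y Z) (ρ : ℝ) (p : Policy Y) : ℝ≥0∞ :=
  ∫⁻ q, (∑' n : ℕ, if ((n + 1 : ℕ) : ℕ∞) ≤ stopTime p q.2 then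
      eveChi2 W (state q.1 (n + 1)) * ENNReal.ofReal (p.probe n (history q.2 n) ^ 2)
    else 0) ∂bayesLaw W ρ p

/-- `ADD⋆(α, δ)`: the least average detection delay under the constraints `PFA ≤ α`, `ECB ≤ δ`. -/
noncomputable def minADD (W : Channel Y Z) (ρ α δ : ℝ) : ℝ≥0∞ :=
  ⨅ (p : Policy Y) (_ : PFA W ρ p ≤ ENNReal.ofReal α ∧ ECB W ρ p ≤ ENNReal.ofReal δ), ADD W ρ p

/-- The least average detection delay of an innocent policy under the constraint `PFA ≤ α`. -/
noncomputable def minInnocentADD (W : Channel Y Z) (ρ α : ℝ) : ℝ≥0∞ :=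
  ⨅ (p : Policy Y) (_ : p.IsInnocent ∧ PFA W ρ p ≤ ENNReal.ofReal α), ADD W ρ p

/-- The coefficient `D √δ / (d^{3/2} √χ_{2,1})`; the factor `1 / √χ_{2,1}` is written as
`√(χ_{2,1}⁻¹)`, so that it is `0` when `χ_{2,1} = ∞`. -/
noncomputable def gainCoeff (W : Channel Y Z) (ρ δ : ℝ) : ℝ :=
  (activeDiv W).toReal * √δ / tailExp ρ ^ (3 / 2 : ℝ) * √((eveChi2 W true)⁻¹.toReal)

end metrics

end CovertQCD

/-!
The lower bound is a change of measure from the law with changepoint `k` to the law without a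
change, applied to the exponential moment `𝔼_∞[e^{-dτ}]`.

Since `e^{-ds}` is the prior probability of `Γ > s` and no law depends on its changepoint before it
occurs, the false alarm probability is `𝔼_∞[e^{-dτ}; τ < ∞]` (`integral_exp_cappedStop_le`). The
Donsker–Varadhan inequality `-ln ∫ e^{-u} dν ≤ ∫ u dμ + 𝔻(μ‖ν)` along Alice's observations turns
this into `|ln α| ≤ d 𝔼_k[τ] + D 𝔼_k[∑_{k < i ≤ τ} β_i]`: an observation taken with sensing
probability `β` carries a divergence of at most `β D`, because the innocent action is uninformative
(`neg_log_integral_obsLaw_le`, and by induction `neg_log_integral_histLaw_le`). The law without a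
change is represented by the one with changepoint `N` on the horizon `N`, with `min(τ, N)` in place
of `τ`; then `N → ∞`.

After the changepoint `β ≤ (l + β² / l) / 2` for every `l > 0` (`sum_probe_le`), and the two terms
add up to at most the delay and the budget divided by `χ_{2,1}`. Averaging over the prior and optimizing
`l` gives `L ≤ d (𝔼Γ + A) + D √(A δ / χ_{2,1})` up to a constant, where `L = |ln α|` and `A` is the
average delay; with `A ≤ L / d`, which may be assumed, this is the claimed bound
(`delay_ge_of_forall_weight`, `le_ADD`). It holds for all `α < 1`.

Conversely the innocent policy that stops at a deterministic time close to `L / d` meets both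
constraints (`exists_waitPolicy`). It gives the matching first-order upper bound and, compared with
the lower bound, the square-root bound on the gain.
-/

namespace CovertQCD

/-! ### The Donsker–Varadhan inequality -/

theorem integrable_of_forall_abs_le {Ω : Type*} [MeasurableSpace Ω] {μ : Measure Ω}
    [IsFiniteMeasure μ] {f : Ω → ℝ} (hf : Measurable f) {M : ℝ} (hM : ∀ x, |f x| ≤ M) :
    Integrable f μ :=
  Integrable.of_bound hf.aestronglyMeasurable M (Eventually.of_forall hM)

/-- The Donsker–Varadhan inequality `-ln ∫ e^{-u} dν ≤ ∫ u dμ + 𝔻(μ‖ν)`. It is Gibbs' inequality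
for `μ` and the exponential tilt of `ν` by `-u`. -/
theorem neg_log_integral_exp_neg_le {Ω : Type*} [MeasurableSpace Ω] {μ ν : Measure Ω}
    [IsProbabilityMeasure μ] [IsProbabilityMeasure ν]
    (hkl : InformationTheory.klDiv μ ν ≠ ∞) {u : Ω → ℝ} (hu : Measurable u) {M : ℝ}
    (hM : ∀ x, |u x| ≤ M) :
    -Real.log (∫ x, Real.exp (-u x) ∂ν) ≤
      ∫ x, u x ∂μ + (InformationTheory.klDiv μ ν).toReal := by
  obtain ⟨hac, hint⟩ := InformationTheory.klDiv_ne_top_iff.1 hkl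
  have hν : Integrable (fun x => Real.exp (-u x)) ν := by
    refine integrable_of_forall_abs_le (M := Real.exp M) (by fun_prop) fun x => ?_
    rw [Real.abs_exp]
    exact Real.exp_le_exp.2 ((neg_le_abs _).trans (hM x))
  have hμ : Integrable (fun x => -u x) μ :=
    integrable_of_forall_abs_le (M := M) (by fun_prop) fun x => by rw [abs_neg]; exact hM x
  have : IsProbabilityMeasure (ν.tilted fun x => -u x) := isProbabilityMeasure_tilted hν
  have hgibbs := InformationTheory.integral_llr_add_sub_measure_univ_nonneg
    (hac.trans (absolutelyContinuous_tilted hν)) (integrable_llr_tilted_right hac hμ hint hν)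
  have hkl' := InformationTheory.toReal_klDiv_of_measure_eq hac
    (by simp : μ Set.univ = ν Set.univ)
  rw [integral_llr_tilted_right hac hμ hν hint, integral_neg] at hgibbs
  simp only [probReal_univ] at hgibbs
  linarith

/-- `-ln ∫ e^{-u}` inherits the bounds on `u`. -/
theorem abs_neg_log_integral_exp_neg_le {Ω : Type*} [MeasurableSpace Ω] {ν : Measure Ω}
    [IsProbabilityMeasure ν] {u : Ω → ℝ} (hu : Measurable u) {M : ℝ} (hM : ∀ x, |u x| ≤ M) :
    |-Real.log (∫ x, Real.exp (-u x) ∂ν)| ≤ M := by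
  have hν : Integrable (fun x => Real.exp (-u x)) ν := by
    refine integrable_of_forall_abs_le (M := Real.exp M) (by fun_prop) fun x => ?_
    rw [Real.abs_exp]
    exact Real.exp_le_exp.2 ((neg_le_abs _).trans (hM x))
  have h1 : Real.exp (-M) ≤ ∫ x, Real.exp (-u x) ∂ν := by
    have := integral_mono (μ := ν) (integrable_const (Real.exp (-M))) hν fun x =>
      Real.exp_le_exp.2 (neg_le_neg ((le_abs_self _).trans (hM x)))
    simpa using this
  have h2 : ∫ x, Real.exp (-u x) ∂ν ≤ Real.exp M := by
    have := integral_mono (μ := ν) hν (integrable_const (Real.exp M)) fun x =>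
      Real.exp_le_exp.2 ((neg_le_abs _).trans (hM x))
    simpa using this
  have h0 := (Real.exp_pos _).trans_le h1
  rw [abs_neg, abs_le]
  exact ⟨(Real.le_log_iff_exp_le h0).2 h1, (Real.log_le_iff_le_exp h0).2 h2⟩

/-! ### The law of Alice's history -/

theorem history_succ {Y : Type*} {Z : Type*} (ω : Path Y Z) (n : ℕ) :
    history ω (n + 1) = Fin.snoc (history ω n) ((ω n).1, (ω n).2.1) := by
  funext i
  refine Fin.lastCases ?_ (fun j => ?_) i
  · simp [history]
  · simp [history]

section law

variable {Y : Type*} {Z : Type*} [MeasurableSpace Y] [MeasurableSpace Z]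

/-- The law of the pair `(X_t, Y_t)` that Alice sees, when `X_t ∼ Ber(b)` and the state is `θ`. -/
noncomputable def obsLaw (W : Channel Y Z) (θ : Bool) (b : ℝ) : Measure (Bool × Y) :=
  (stepLaw W θ b).map fun w => (w.1, w.2.1)

theorem isProbabilityMeasure_obsLaw (W : Channel Y Z) (θ : Bool) {b : ℝ}
    (hb : b ∈ Set.Icc (0 : ℝ) 1) : IsProbabilityMeasure (obsLaw W θ b) := by
  have := stepLaw_isProbabilityMeasure W θ b hb
  exact Measure.isProbabilityMeasure_map (by fun_prop)

theorem toMeasure_aliceChannel (W : Channel Y Z) (x θ : Bool) :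
    (aliceChannel W x θ).toMeasure = (W x θ).toMeasure.map Prod.fst := by
  exact (PMF.toMeasure_map Prod.fst _ measurable_fst).symm

theorem obsLaw_eq (W : Channel Y Z) (θ : Bool) (b : ℝ) :
    obsLaw W θ b = ENNReal.ofReal b • (aliceChannel W true θ).toMeasure.map (Prod.mk true)
      + ENNReal.ofReal (1 - b) • (aliceChannel W false θ).toMeasure.map (Prod.mk false) := by
  simp only [obsLaw, stepLaw, toMeasure_aliceChannel]
  rw [Measure.map_add _ _ (by fun_prop), Measure.map_smul, Measure.map_smul]
  simp only [Measure.map_map (g := fun w : Bool × Y × Z => (w.1, w.2.1)) (by fun_prop)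
    measurable_prodMk_left, Measure.map_map measurable_prodMk_left measurable_fst]
  rfl

@[fun_prop]
theorem measurable_history (n : ℕ) : Measurable fun ω : Path Y Z => history ω n := by
  unfold history
  fun_prop

variable [Countable Y] [MeasurableSingletonClass Y]

theorem integral_obsLaw (W : Channel Y Z) (θ : Bool) {b : ℝ} (hb : b ∈ Set.Icc (0 : ℝ) 1)
    {f : Bool × Y → ℝ} {M : ℝ} (hM : ∀ w, |f w| ≤ M) :
    ∫ w, f w ∂obsLaw W θ b = b * ∫ y, f (true, y) ∂(aliceChannel W true θ).toMeasure
      + (1 - b) * ∫ y, f (false, y) ∂(aliceChannel W false θ).toMeasure := by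
  have hf : Measurable f := measurable_of_countable f
  have hx (x : Bool) : Integrable f ((aliceChannel W x θ).toMeasure.map (Prod.mk x)) := by
    have := Measure.isProbabilityMeasure_map (μ := (aliceChannel W x θ).toMeasure)
      (f := Prod.mk x) (by fun_prop)
    exact integrable_of_forall_abs_le hf hM
  rw [obsLaw_eq, integral_add_measure ((hx true).smul_measure ENNReal.ofReal_ne_top)
    ((hx false).smul_measure ENNReal.ofReal_ne_top), integral_smul_measure, integral_smul_measure,
    integral_map (by fun_prop) hf.aestronglyMeasurable,
    integral_map (by fun_prop) hf.aestronglyMeasurable, ENNReal.toReal_ofReal hb.1,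
    ENNReal.toReal_ofReal (sub_nonneg.2 hb.2), smul_eq_mul, smul_eq_mul]

/-- One step of the change of measure: passing from state `0` to state `1` costs at most `b D` nats, since
the innocent action gives no information and the action itself has the same law in both states. -/
theorem neg_log_integral_obsLaw_le (W : Channel Y Z)
    (hP : aliceChannel W false true = aliceChannel W false false)
    (hDtop : activeDiv W < ∞) (θ : Bool) {b : ℝ} (hb : b ∈ Set.Icc (0 : ℝ) 1)
    {u : Bool × Y → ℝ} {M : ℝ} (hM : ∀ w, |u w| ≤ M) :
    -Real.log (∫ w, Real.exp (-u w) ∂obsLaw W false b) ≤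
      ∫ w, u w ∂obsLaw W θ b + (activeDiv W).toReal * (if θ then b else 0) := by
  have hmeas (x : Bool) : Measurable fun y => u (x, y) := measurable_of_countable _
  have hexp (w) : |Real.exp (-u w)| ≤ Real.exp M := by
    rw [Real.abs_exp]
    exact Real.exp_le_exp.2 ((neg_le_abs _).trans (hM w))
  have hself (x : Bool) := neg_log_integral_exp_neg_le
    (μ := (aliceChannel W x false).toMeasure) (ν := (aliceChannel W x false).toMeasure)
    (by simp) (hmeas x) fun y => hM (x, y)
  simp only [InformationTheory.klDiv_self, ENNReal.toReal_zero, add_zero] at hself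
  have hactive := neg_log_integral_exp_neg_le
    (μ := (aliceChannel W true true).toMeasure) (ν := (aliceChannel W true false).toMeasure)
    hDtop.ne (hmeas true) fun y => hM (true, y)
  have hpos (x : Bool) : 0 < ∫ y, Real.exp (-u (x, y)) ∂(aliceChannel W x false).toMeasure := by
    refine integral_exp_pos (integrable_of_forall_abs_le ?_ fun y => hexp (x, y))
    have := hmeas x
    fun_prop
  have hconc := strictConcaveOn_log_Ioi.concaveOn.2 (hpos true) (hpos false) hb.1
    (sub_nonneg.2 hb.2) (add_sub_cancel _ _)
  rw [integral_obsLaw W false hb hexp, integral_obsLaw W θ hb hM]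
  simp only [smul_eq_mul] at hconc
  cases θ
  · have h1 := mul_le_mul_of_nonneg_left (hself true) hb.1
    have h2 := mul_le_mul_of_nonneg_left (hself false) (sub_nonneg.2 hb.2)
    simp only [Bool.false_eq_true, if_false]
    linarith
  · have h1 := mul_le_mul_of_nonneg_left hactive hb.1
    have h2 := mul_le_mul_of_nonneg_left (hself false) (sub_nonneg.2 hb.2)
    rw [hP]
    simp only [if_true]
    change _ ≤ _ + (InformationTheory.klDiv (aliceChannel W true true).toMeasure
      (aliceChannel W true false).toMeasure).toReal * b
    linarith

variable [Countable Z] [MeasurableSingletonClass Z]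

instance (W : Channel Y Z) (p : Policy Y) (k : ℕ) : IsProbabilityMeasure (pathLaw W p k) := by
  have := stepLaw_isProbabilityMeasure W (state k 1) (p.probe 0 Fin.elim0) (p.probe_mem _ _)
  unfold pathLaw
  infer_instance

/-- The kernel that produces Alice's next observation from her history. -/
noncomputable def obsKernel (W : Channel Y Z) (p : Policy Y) (k n : ℕ) :
    Kernel (Fin n → Bool × Y) (Bool × Y) :=
  Kernel.ofFunOfCountable fun h => obsLaw W (state k (n + 1)) (p.probe n h)

instance (W : Channel Y Z) (p : Policy Y) (k n : ℕ) : IsMarkovKernel (obsKernel W p k n) :=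
  ⟨fun _ => isProbabilityMeasure_obsLaw _ _ (p.probe_mem _ _)⟩

/-- The law of Alice's history `(X^n, Y^n)` when the changepoint is `k`. -/
noncomputable def histLaw (W : Channel Y Z) (p : Policy Y) (k n : ℕ) :
    Measure (Fin n → Bool × Y) :=
  (pathLaw W p k).map fun ω => history ω n

instance (W : Channel Y Z) (p : Policy Y) (k n : ℕ) : IsProbabilityMeasure (histLaw W p k n) :=
  Measure.isProbabilityMeasure_map (by fun_prop)

theorem map_eval_zero_pathLaw (W : Channel Y Z) (p : Policy Y) (k : ℕ) :
    (pathLaw W p k).map (fun ω => ω 0) = stepLaw W (state k 1) (p.probe 0 Fin.elim0) := by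
  have h0 : (fun ω : Path Y Z => ω 0) =
      (MeasurableEquiv.piUnique fun _ : Finset.Iic 0 => Bool × Y × Z) ∘
        Preorder.frestrictLe (π := fun _ : ℕ => Bool × Y × Z) 0 := rfl
  rw [h0, ← Measure.map_map (by fun_prop) (by fun_prop), pathLaw, Kernel.trajMeasure,
    Measure.map_comp _ _ (by fun_prop), Kernel.traj_map_frestrictLe, Kernel.partialTraj_self,
    Measure.id_comp, Measure.map_map (by fun_prop) (by fun_prop)]
  exact Measure.map_id

theorem lintegral_history_succ (W : Channel Y Z) (p : Policy Y) (k n : ℕ)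
    (f : (Fin (n + 1) → Bool × Y) → ℝ≥0∞) :
    ∫⁻ ω, f (history ω (n + 1)) ∂pathLaw W p k =
      ∫⁻ ω, ∫⁻ w, f (Fin.snoc (history ω n) w) ∂obsKernel W p k n (history ω n)
        ∂pathLaw W p k := by
  have hker (h : Fin n → Bool × Y) : ∫⁻ w, f (Fin.snoc h w) ∂obsKernel W p k n h =
      ∫⁻ w, f (Fin.snoc h (w.1, w.2.1)) ∂stepLaw W (state k (n + 1)) (p.probe n h) :=
    lintegral_map (measurable_of_countable fun w => f (Fin.snoc h w)) (by fun_prop)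
  simp only [hker, history_succ]
  rcases n with _ | n
  · have h0 (ω : Path Y Z) : history ω 0 = Fin.elim0 := Subsingleton.elim _ _
    simp only [h0, lintegral_const, measure_univ, mul_one]
    have h1 := map_eval_zero_pathLaw W p k
    rw [← zero_add 1] at h1
    rw [← h1, lintegral_map (measurable_of_countable _) (by fun_prop)]
  · have := stepLaw_isProbabilityMeasure W (state k 1) (p.probe 0 Fin.elim0) (p.probe_mem _ _)
    have hcomp := Kernel.map_frestrictLe_trajMeasure_compProd_eq_map_trajMeasure
      (X := fun _ : ℕ => Bool × Y × Z) (κ := stepKernel W p k)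
      (μ₀ := stepLaw W (state k 1) (p.probe 0 Fin.elim0)) (a := n)
    -- Alice's history as a function of the first `n + 1` steps of the path
    set g : ((i : Finset.Iic n) → (fun _ : ℕ => Bool × Y × Z) i) → (Fin (n + 1) → Bool × Y) :=
      fun h i => ((h ⟨i, Finset.mem_Iic.2 (Nat.lt_succ_iff.1 i.2)⟩).1,
        (h ⟨i, Finset.mem_Iic.2 (Nat.lt_succ_iff.1 i.2)⟩).2.1) with hg
    have hl := congrArg (fun μ => ∫⁻ q, f (Fin.snoc (g q.1) (q.2.1, q.2.2.1)) ∂μ) hcomp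
    rw [Measure.lintegral_compProd (measurable_of_countable _),
      lintegral_map (measurable_of_countable _) (by fun_prop),
      lintegral_map (measurable_of_countable _) (by fun_prop)] at hl
    exact hl.symm

theorem histLaw_succ (W : Channel Y Z) (p : Policy Y) (k n : ℕ) :
    histLaw W p k (n + 1) = (histLaw W p k n ⊗ₘ obsKernel W p k n).map
      fun q => (Fin.snoc q.1 q.2 : Fin (n + 1) → Bool × Y) := by
  refine Measure.ext_of_lintegral _ fun f hf => ?_
  rw [histLaw, lintegral_map hf (by fun_prop), lintegral_history_succ,
    lintegral_map hf (measurable_of_countable _),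
    Measure.lintegral_compProd (measurable_of_countable _), histLaw,
    lintegral_map (measurable_of_countable _) (by fun_prop)]

theorem integral_histLaw_succ (W : Channel Y Z) (p : Policy Y) (k n : ℕ)
    {f : (Fin (n + 1) → Bool × Y) → ℝ} {M : ℝ} (hM : ∀ h, |f h| ≤ M) :
    ∫ h, f h ∂histLaw W p k (n + 1) =
      ∫ h, ∫ w, f (Fin.snoc h w) ∂obsLaw W (state k (n + 1)) (p.probe n h) ∂histLaw W p k n := by
  rw [histLaw_succ, integral_map (measurable_of_countable _).aemeasurable
    (measurable_of_countable f).aestronglyMeasurable, Measure.integral_compProd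
    (integrable_of_forall_abs_le (measurable_of_countable _) fun q => hM _)]
  rfl

/-- Before the changepoint nothing depends on it. -/
theorem histLaw_congr (W : Channel Y Z) (p : Policy Y) {k l : ℕ} :
    ∀ {n : ℕ}, n ≤ k → n ≤ l → histLaw W p k n = histLaw W p l n
  | 0, _, _ => Measure.ext_of_lintegral _ fun f hf => by
      have (μ : Measure (Fin 0 → Bool × Y)) [IsProbabilityMeasure μ] :
          ∫⁻ h, f h ∂μ = f Fin.elim0 := by
        rw [lintegral_congr fun h => congrArg f (Subsingleton.elim h Fin.elim0)]
        simp
      rw [this, this]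
  | n + 1, hk, hl => by
      have hker : obsKernel W p k n = obsKernel W p l n := by
        ext h : 1
        simp only [obsKernel, Kernel.ofFunOfCountable, Kernel.coe_mk, state,
          decide_eq_false (not_lt.2 hk), decide_eq_false (not_lt.2 hl)]
      rw [histLaw_succ, histLaw_succ,
        histLaw_congr W p (Nat.le_of_succ_le hk) (Nat.le_of_succ_le hl), hker]

/-- The change of measure from `P_N` to `P_k` along Alice's first `n ≤ N` observations, in
Donsker–Varadhan form; the divergence is paid only for the probes sent after `k`. -/
theorem neg_log_integral_histLaw_le (W : Channel Y Z)
    (hP : aliceChannel W false true = aliceChannel W false false)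
    (hDtop : activeDiv W < ∞) (p : Policy Y) (k N : ℕ) {M : ℝ} :
    ∀ {n : ℕ}, n ≤ N → ∀ {u : (Fin n → Bool × Y) → ℝ}, (∀ h, |u h| ≤ M) →
      -Real.log (∫ h, Real.exp (-u h) ∂histLaw W p N n) ≤
        ∫ h, u h ∂histLaw W p k n + (activeDiv W).toReal *
          ∑ i ∈ Finset.range n, if k ≤ i then ∫ h, p.probe i h ∂histLaw W p k i else 0
  | 0, _, u, hM => by
      have (μ : Measure (Fin 0 → Bool × Y)) [IsProbabilityMeasure μ]
          (f : (Fin 0 → Bool × Y) → ℝ) : ∫ h, f h ∂μ = f Fin.elim0 := by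
        rw [integral_congr_ae (Eventually.of_forall fun h =>
          congrArg f (Subsingleton.elim h Fin.elim0))]
        simp
      rw [this, this]
      simp
  | n + 1, hn, u, hM => by
      have hprob (h) := isProbabilityMeasure_obsLaw W (state k (n + 1)) (p.probe_mem n h)
      have hprob0 (h) := isProbabilityMeasure_obsLaw W false (p.probe_mem n h)
      have hexp (w) : |Real.exp (-u w)| ≤ Real.exp M := by
        rw [Real.abs_exp]
        exact Real.exp_le_exp.2 ((neg_le_abs _).trans (hM w))
      -- the conditional counterpart of `-ln ∫ e^{-u}` given the first `n` observations
      set v : (Fin n → Bool × Y) → ℝ := fun h =>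
        -Real.log (∫ w, Real.exp (-u (Fin.snoc h w)) ∂obsLaw W false (p.probe n h)) with hv
      have hvM (h) : |v h| ≤ M :=
        abs_neg_log_integral_exp_neg_le (measurable_of_countable _) fun w => hM _
      have hexpv (h) : Real.exp (-v h) =
          ∫ w, Real.exp (-u (Fin.snoc h w)) ∂obsLaw W false (p.probe n h) := by
        rw [hv, neg_neg, Real.exp_log]
        exact integral_exp_pos
          (integrable_of_forall_abs_le (measurable_of_countable _) fun w => hexp _)
      have hstate : state N (n + 1) = false := decide_eq_false (not_lt.2 hn)
      have hind := neg_log_integral_histLaw_le W hP hDtop p k N (Nat.le_of_succ_le hn) hvM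
      have hstep : ∫ h, v h ∂histLaw W p k n ≤
          ∫ h, u h ∂histLaw W p k (n + 1) + (activeDiv W).toReal *
            (if k ≤ n then ∫ h, p.probe n h ∂histLaw W p k n else 0) := by
        have hb : Integrable (fun h => (activeDiv W).toReal *
            (if state k (n + 1) then p.probe n h else 0)) (histLaw W p k n) := by
          refine Integrable.const_mul (integrable_of_forall_abs_le (M := 1)
            (measurable_of_countable _) fun h => ?_) _
          have := p.probe_mem n h
          split_ifs <;> simp [abs_of_nonneg this.1, this.2]
        have hu : Integrable (fun h => ∫ w, u (Fin.snoc h w)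
            ∂obsLaw W (state k (n + 1)) (p.probe n h)) (histLaw W p k n) := by
          refine integrable_of_forall_abs_le (M := M) (measurable_of_countable _) fun h => ?_
          refine (norm_integral_le_of_norm_le_const (f := fun w => u (Fin.snoc h w)) (C := M)
            (Eventually.of_forall fun w => hM (Fin.snoc h w))).trans ?_
          simp
        refine (integral_mono (integrable_of_forall_abs_le (measurable_of_countable _) hvM)
          (hu.add hb) fun h => neg_log_integral_obsLaw_le W hP hDtop (state k (n + 1))
            (p.probe_mem n h) fun w => hM (Fin.snoc h w)).trans_eq ?_
        rw [integral_add' hu hb, integral_histLaw_succ W p k n hM, integral_const_mul]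
        by_cases hkn : k ≤ n
        · simp [state, hkn]
        · simp [state, hkn]
      rw [Finset.sum_range_succ, integral_histLaw_succ W p N n hexp, hstate, mul_add]
      simp only [← hexpv]
      linarith

end law

/-! ### The geometric prior -/

theorem prior_nonneg {ρ : ℝ} (hρ0 : 0 < ρ) (hρ1 : ρ < 1) (k : ℕ) : 0 ≤ prior ρ k := by
  have : 0 < 1 - ρ := by linarith
  unfold prior
  split_ifs <;> positivity

theorem tailExp_eq {ρ : ℝ} (hρ0 : 0 < ρ) (hρ1 : ρ < 1) : tailExp ρ = -Real.log (1 - ρ) :=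
  abs_of_neg (Real.log_neg (by linarith) (by linarith))

theorem tailExp_pos {ρ : ℝ} (hρ0 : 0 < ρ) (hρ1 : ρ < 1) : 0 < tailExp ρ := by
  rw [tailExp_eq hρ0 hρ1, neg_pos]
  exact Real.log_neg (by linarith) (by linarith)

theorem exp_neg_tailExp_mul {ρ : ℝ} (hρ0 : 0 < ρ) (hρ1 : ρ < 1) (n : ℕ) :
    Real.exp (-(tailExp ρ * n)) = (1 - ρ) ^ n := by
  rw [tailExp_eq hρ0 hρ1, neg_mul, neg_neg, mul_comm, Real.exp_nat_mul,
    Real.exp_log (by linarith)]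

theorem tsum_prior_tail {ρ : ℝ} (hρ0 : 0 < ρ) (hρ1 : ρ < 1) (s : ℕ) :
    ∑' k, ENNReal.ofReal (prior ρ k) * (if s < k then 1 else 0) =
      ENNReal.ofReal ((1 - ρ) ^ s) := by
  have h0 : ∑ k ∈ Finset.range (s + 1),
      ENNReal.ofReal (prior ρ k) * (if s < k then 1 else 0) = 0 :=
    Finset.sum_eq_zero fun k hk => by
      rw [if_neg (by simpa [Nat.lt_succ_iff] using hk), mul_zero]
  have hsum : HasSum (fun j : ℕ => ρ * (1 - ρ) ^ s * (1 - ρ) ^ j) ((1 - ρ) ^ s) := by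
    have := (hasSum_geometric_of_lt_one (r := 1 - ρ) (by linarith) (by linarith)).mul_left
      (ρ * (1 - ρ) ^ s)
    rwa [sub_sub_cancel, mul_right_comm, mul_inv_cancel₀ hρ0.ne', one_mul] at this
  have hnn (j : ℕ) : 0 ≤ ρ * (1 - ρ) ^ s * (1 - ρ) ^ j := by
    have : 0 < 1 - ρ := by linarith
    positivity
  have hterm (j : ℕ) : ENNReal.ofReal (prior ρ (j + (s + 1))) *
      (if s < j + (s + 1) then 1 else 0) = ENNReal.ofReal (ρ * (1 - ρ) ^ s * (1 - ρ) ^ j) := by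
    have hpow : j + (s + 1) - 1 = s + j := by omega
    rw [if_pos (by omega), mul_one, prior, if_neg (by omega), hpow, pow_add, mul_assoc]
  have hsplit := Summable.sum_add_tsum_nat_add' (f := fun k =>
    ENNReal.ofReal (prior ρ k) * (if s < k then 1 else 0)) (k := s + 1) ENNReal.summable
  rw [h0, zero_add] at hsplit
  rw [← hsplit, tsum_congr hterm, ← ENNReal.ofReal_tsum_of_nonneg hnn hsum.summable, hsum.tsum_eq]

theorem tsum_prior {ρ : ℝ} (hρ0 : 0 < ρ) (hρ1 : ρ < 1) :
    ∑' k, ENNReal.ofReal (prior ρ k) = 1 := by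
  have := tsum_prior_tail hρ0 hρ1 0
  rw [pow_zero, ENNReal.ofReal_one] at this
  rw [← this]
  refine tsum_congr fun k => ?_
  rcases Nat.eq_zero_or_pos k with rfl | hk
  · simp [prior]
  · simp [hk]

theorem tsum_prior_mul_ne_top {ρ : ℝ} (hρ0 : 0 < ρ) (hρ1 : ρ < 1) :
    ∑' k, ENNReal.ofReal (prior ρ k) * (k : ℝ≥0∞) ≠ ∞ := by
  have h0 : 0 < 1 - ρ := by linarith
  have hs : Summable fun k : ℕ => ρ / (1 - ρ) * ((k : ℝ) ^ 1 * (1 - ρ) ^ k) :=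
    (summable_pow_mul_geometric_of_norm_lt_one 1 (r := 1 - ρ)
      (by rw [Real.norm_of_nonneg h0.le]; linarith)).mul_left _
  refine ne_top_of_le_ne_top hs.tsum_ofReal_ne_top (ENNReal.tsum_le_tsum fun k => ?_)
  rw [← ENNReal.ofReal_natCast k, ← ENNReal.ofReal_mul (prior_nonneg hρ0 hρ1 k)]
  refine ENNReal.ofReal_le_ofReal (le_of_eq ?_)
  rcases k with _ | k
  · simp
  · simp only [prior, Nat.succ_ne_zero, if_false, Nat.add_sub_cancel]
    field_simp
    ring

/-! ### The stopping time -/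

section stoppingTime

variable {Y : Type*} {Z : Type*}

theorem stopTime_lt_iff (p : Policy Y) (ω : Path Y Z) (n : ℕ) :
    stopTime p ω < n ↔ ∃ m, p.halt m (history ω m) = true ∧ m + 1 < n := by
  simp only [stopTime, iInf_lt_iff, Nat.cast_lt, exists_prop]

theorem stopTime_le_iff (p : Policy Y) (ω : Path Y Z) (n : ℕ) :
    stopTime p ω ≤ n ↔ ∃ m, p.halt m (history ω m) = true ∧ m < n := by
  have := stopTime_lt_iff p ω (n + 1)
  rw [Nat.cast_add, Nat.cast_one, ENat.lt_add_one_iff (ENat.natCast_ne_top n)] at this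
  simpa using this

/-- `min(τ, N)` as a function of the first `N` observations. -/
def cappedStop (p : Policy Y) (N : ℕ) (h : Fin N → Bool × Y) : ℕ :=
  (Finset.univ.filter fun j : Fin N =>
    ∀ m : Fin N, m < j → p.halt m (fun i => h (Fin.castLE m.2.le i)) = false).card

theorem cappedStop_le (p : Policy Y) (N : ℕ) (h : Fin N → Bool × Y) : cappedStop p N h ≤ N :=
  (Finset.card_filter_le _ _).trans (by simp)

theorem abs_tailExp_mul_cappedStop_le {ρ : ℝ} (hρ0 : 0 < ρ) (hρ1 : ρ < 1) (p : Policy Y) (N : ℕ)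
    (h : Fin N → Bool × Y) : |tailExp ρ * cappedStop p N h| ≤ tailExp ρ * N := by
  have := tailExp_pos hρ0 hρ1
  rw [abs_of_nonneg (by positivity)]
  exact mul_le_mul_of_nonneg_left (Nat.cast_le.2 (cappedStop_le p N h)) this.le

theorem cappedStop_history (p : Policy Y) (N : ℕ) (ω : Path Y Z) :
    (cappedStop p N (history ω N) : ℕ∞) = min (stopTime p ω) N := by
  obtain ⟨s, hs⟩ := ENat.ne_top_iff_exists.1
    (ne_top_of_le_ne_top (ENat.natCast_ne_top N) (min_le_right (stopTime p ω) N))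
  have hsN : s ≤ N := by
    rw [← Nat.cast_le (α := ℕ∞), hs]
    exact min_le_right _ _
  rw [← hs, cappedStop]
  have hfilter : (Finset.univ.filter fun j : Fin N => ∀ m : Fin N, m < j →
      p.halt m (fun i => history ω N (Fin.castLE m.2.le i)) = false) =
      Finset.univ.filter fun j : Fin N => (j : ℕ) < s := by
    refine Finset.filter_congr fun j _ => ?_
    have hj : ((j : ℕ) : ℕ∞) < N := Nat.cast_lt.2 j.2
    rw [← Nat.cast_lt (α := ℕ∞), hs, lt_min_iff, and_iff_left hj, ← not_le, stopTime_le_iff]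
    push Not
    constructor
    · intro h m hm
      by_contra! hlt
      exact absurd hm (by
        have := h ⟨m, hlt.trans j.2⟩ hlt
        exact Bool.eq_false_iff.1 this)
    · intro h m hm
      by_contra hne
      exact absurd hm (not_lt.2 (h m (Bool.eq_true_of_not_eq_false hne)))
  rw [hfilter, Fin.card_filter_val_lt, min_eq_right hsN]

theorem probe_eq_zero_of_stopTime_le (p : Policy Y) (ω : Path Y Z) (n : ℕ)
    (h : stopTime p ω ≤ ((n + 1 : ℕ) : ℕ∞)) : p.probe n (history ω n) = 0 := by
  obtain ⟨m, hm, hmn⟩ := (stopTime_le_iff p ω (n + 1)).1 h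
  exact p.probe_eq_zero n _ ⟨m, Nat.lt_succ_iff.1 hmn, hm⟩

/-- The number of time steps in `(k, t]` is at most `(t - k)⁺`. -/
theorem tsum_indicator_le_sub (t : ℕ∞) (k : ℕ) :
    ∑' i : ℕ, (if k ≤ i ∧ ((i + 1 : ℕ) : ℕ∞) ≤ t then 1 else 0 : ℝ≥0∞) ≤
      ((t - (k : ℕ∞) : ℕ∞) : ℝ≥0∞) := by
  induction t using ENat.recTopCoe with
  | top => simp
  | coe t =>
    have hsub : ((t : ℕ∞) - (k : ℕ∞) : ℕ∞) = ((t - k : ℕ) : ℕ∞) := by simp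
    rw [hsub, ENat.toENNReal_coe, tsum_eq_sum (s := Finset.Ico k t)]
    · refine (Finset.sum_le_card_nsmul _ _ 1 fun i _ => ?_).trans (by simp)
      split_ifs <;> simp
    · intro i hi
      rw [if_neg]
      rintro ⟨h1, h2⟩
      exact hi (Finset.mem_Ico.2 ⟨h1, Nat.cast_le.1 h2⟩)

/-- The squared probing probabilities spent after the changepoint `k`. -/
noncomputable def postBudget (p : Policy Y) (k : ℕ) (ω : Path Y Z) : ℝ≥0∞ :=
  open Classical in
  ∑' i : ℕ, if k ≤ i ∧ ((i + 1 : ℕ) : ℕ∞) ≤ stopTime p ω then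
    ENNReal.ofReal (p.probe i (history ω i) ^ 2) else 0

/-- The probes after the changepoint are controlled through `β ≤ (l + β² / l) / 2`: the first term
adds up to the delay, the second to the covertness budget. -/
theorem sum_probe_le (p : Policy Y) (ω : Path Y Z) (k N : ℕ) {l : ℝ} (hl : 0 < l) :
    ENNReal.ofReal (∑ i ∈ Finset.range N, if k ≤ i then p.probe i (history ω i) else 0) ≤
      ENNReal.ofReal (l / 2) * ((stopTime p ω - (k : ℕ∞) : ℕ∞) : ℝ≥0∞) +
        ENNReal.ofReal (1 / (2 * l)) * postBudget p k ω := by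
  classical
  have hβ (i) := p.probe_mem i (history ω i)
  rw [ENNReal.ofReal_sum_of_nonneg fun i _ => by split_ifs <;> simp [(hβ i).1]]
  refine (ENNReal.sum_le_tsum _).trans ?_
  refine le_trans ?_ (add_le_add_left
    (mul_le_mul_right (tsum_indicator_le_sub (stopTime p ω) k) _) _)
  rw [postBudget, ← ENNReal.tsum_mul_left, ← ENNReal.tsum_mul_left,
    ← ENNReal.summable.tsum_add ENNReal.summable]
  refine ENNReal.tsum_le_tsum fun i => ?_
  by_cases hi : k ≤ i ∧ ((i + 1 : ℕ) : ℕ∞) ≤ stopTime p ω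
  · rw [if_pos hi.1, if_pos hi, if_pos hi, mul_one, ← ENNReal.ofReal_mul (by positivity),
      ← ENNReal.ofReal_add (by positivity) (by positivity)]
    refine ENNReal.ofReal_le_ofReal ?_
    have : l / 2 + 1 / (2 * l) * p.probe i (history ω i) ^ 2 - p.probe i (history ω i) =
        (l - p.probe i (history ω i)) ^ 2 / (2 * l) := by
      field_simp
      ring
    have h2 : 0 ≤ (l - p.probe i (history ω i)) ^ 2 / (2 * l) := by positivity
    linarith
  · have h0 : (if k ≤ i then p.probe i (history ω i) else 0) = 0 := by
      split_ifs with hk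
      · exact probe_eq_zero_of_stopTime_le p ω i (le_of_not_ge fun h => hi ⟨hk, h⟩)
      · rfl
    rw [h0]
    simp

end stoppingTime

section measurable

variable {Y : Type*} {Z : Type*} [MeasurableSpace Y] [MeasurableSpace Z]
  [Countable Y] [MeasurableSingletonClass Y]

theorem measurableSet_stopTime_lt (p : Policy Y) (n : ℕ) :
    MeasurableSet {ω : Path Y Z | stopTime p ω < n} := by
  simp only [stopTime_lt_iff, Set.ofPred_exists]
  refine MeasurableSet.iUnion fun m => MeasurableSet.inter ?_ (MeasurableSet.const _)
  exact measurable_history m (Set.to_countable {h | p.halt m h = true}).measurableSet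

@[fun_prop]
theorem measurable_stopTime (p : Policy Y) :
    Measurable fun ω : Path Y Z => stopTime p ω := by
  refine ENat.measurable_iff.2 fun n => ?_
  have : (fun ω : Path Y Z => stopTime p ω) ⁻¹' {(n : ℕ∞)} =
      {ω | stopTime p ω < ((n + 1 : ℕ) : ℕ∞)} \ {ω | stopTime p ω < n} := by
    ext ω
    have := ENat.lt_add_one_iff (m := stopTime p ω) (ENat.natCast_ne_top n)
    simp only [Set.mem_preimage, Set.mem_singleton_iff, Set.mem_sdiff, Set.mem_ofPred_eq,
      Nat.cast_add, Nat.cast_one, this, not_lt]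
    exact ⟨fun h => ⟨h.le, h.ge⟩, fun h => le_antisymm h.1 h.2⟩
  rw [this]
  exact (measurableSet_stopTime_lt p _).diff (measurableSet_stopTime_lt p _)

theorem measurable_delay (p : Policy Y) (k : ℕ) :
    Measurable fun ω : Path Y Z => ((stopTime p ω - (k : ℕ∞) : ℕ∞) : ℝ≥0∞) :=
  (measurable_from_top (f := fun t : ℕ∞ => ((t - (k : ℕ∞) : ℕ∞) : ℝ≥0∞))).comp
    (measurable_stopTime p)

theorem measurable_probe (p : Policy Y) (n : ℕ) :
    Measurable fun ω : Path Y Z => p.probe n (history ω n) :=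
  (measurable_of_countable (p.probe n)).comp (measurable_history n)

theorem measurableSet_le_stopTime (p : Policy Y) (n : ℕ) :
    MeasurableSet {ω : Path Y Z | (n : ℕ∞) ≤ stopTime p ω} := by
  simp only [← not_lt]
  exact (measurableSet_stopTime_lt p n).compl

theorem measurable_postBudget (p : Policy Y) (k : ℕ) :
    Measurable fun ω : Path Y Z => postBudget p k ω := by
  classical
  refine Measurable.tsum fun i => Measurable.ite
    ((MeasurableSet.const _).inter (measurableSet_le_stopTime p (i + 1))) ?_ measurable_const
  exact ((measurable_probe p i).pow_const 2).ennreal_ofReal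

/-! ### Mixing over the changepoint -/

variable [Countable Z] [MeasurableSingletonClass Z]

theorem lintegral_bayesLaw (W : Channel Y Z) (ρ : ℝ) (p : Policy Y) {f : ℕ × Path Y Z → ℝ≥0∞}
    (hf : ∀ k, Measurable fun ω => f (k, ω)) :
    ∫⁻ q, f q ∂bayesLaw W ρ p =
      ∑' k, ENNReal.ofReal (prior ρ k) * ∫⁻ ω, f (k, ω) ∂pathLaw W p k := by
  have hf' : Measurable f := measurable_from_prod_countable_right hf
  rw [bayesLaw, lintegral_sum_measure]
  refine tsum_congr fun k => ?_
  rw [lintegral_smul_measure, lintegral_map hf' measurable_prodMk_left, smul_eq_mul]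

theorem PFA_eq (W : Channel Y Z) (ρ : ℝ) (p : Policy Y) :
    PFA W ρ p =
      ∑' k, ENNReal.ofReal (prior ρ k) * pathLaw W p k {ω | stopTime p ω < k} := by
  have hS : MeasurableSet {q : ℕ × Path Y Z | stopTime p q.2 < (q.1 : ℕ∞)} :=
    (measurable_from_prod_countable_right (f := fun q : ℕ × Path Y Z => (q.1, stopTime p q.2))
      fun k => by fun_prop) (Set.to_countable {q : ℕ × ℕ∞ | q.2 < (q.1 : ℕ∞)}).measurableSet
  rw [PFA, bayesLaw, Measure.sum_apply _ hS]
  refine tsum_congr fun k => ?_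
  rw [Measure.smul_apply, Measure.map_apply measurable_prodMk_left hS, smul_eq_mul]
  rfl

theorem ADD_eq (W : Channel Y Z) (ρ : ℝ) (p : Policy Y) :
    ADD W ρ p = ∑' k, ENNReal.ofReal (prior ρ k) *
      ∫⁻ ω, ((stopTime p ω - (k : ℕ∞) : ℕ∞) : ℝ≥0∞) ∂pathLaw W p k :=
  lintegral_bayesLaw W ρ p fun k => measurable_delay p k

/-- Only the covertness budget spent after the changepoint is used. -/
theorem le_ECB (W : Channel Y Z) (ρ : ℝ) (p : Policy Y) :
    eveChi2 W true * ∑' k, ENNReal.ofReal (prior ρ k) * ∫⁻ ω, postBudget p k ω ∂pathLaw W p k ≤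
      ECB W ρ p := by
  classical
  have hm (k i : ℕ) : Measurable fun ω : Path Y Z =>
      if ((i + 1 : ℕ) : ℕ∞) ≤ stopTime p ω then
        eveChi2 W (state k (i + 1)) * ENNReal.ofReal (p.probe i (history ω i) ^ 2) else 0 :=
    Measurable.ite (measurableSet_le_stopTime p (i + 1))
      (((measurable_probe p i).pow_const 2).ennreal_ofReal.const_mul _) measurable_const
  rw [ECB, lintegral_bayesLaw W ρ p fun k => ?_, ← ENNReal.tsum_mul_left]
  · refine ENNReal.tsum_le_tsum fun k => ?_
    rw [mul_left_comm, ← lintegral_const_mul _ (measurable_postBudget p k)]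
    refine mul_le_mul_right (lintegral_mono fun ω => ?_) _
    simp only [postBudget]
    rw [← ENNReal.tsum_mul_left]
    refine ENNReal.tsum_le_tsum fun i => ?_
    by_cases hi : k ≤ i
    · have : state k (i + 1) = true := decide_eq_true (Nat.lt_succ_iff.2 hi)
      simp only [hi, true_and, this, mul_ite, mul_zero]
      split_ifs <;> simp
    · simp [hi]
  · convert Measurable.tsum fun i => hm k i using 6 <;> infer_instance

end measurable

/-! ### The lower bound -/

theorem chi2_ne_zero {Z : Type*} {P Q : PMF Z} (hac : ∀ z, Q z = 0 → P z = 0) (hne : P ≠ Q) :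
    chi2 P Q ≠ 0 := by
  intro h
  refine hne (PMF.ext fun z => ?_)
  have hz := ENNReal.tsum_eq_zero.1 h z
  by_cases hQ : Q z = 0
  · rw [hQ, hac z hQ]
  · have hpos : 0 < (Q z).toReal := ENNReal.toReal_pos hQ (Q.apply_ne_top z)
    rw [ENNReal.ofReal_eq_zero, div_le_iff₀ hpos, zero_mul] at hz
    have := pow_eq_zero_iff (two_ne_zero) |>.1 (le_antisymm hz (sq_nonneg _))
    exact (ENNReal.toReal_eq_toReal_iff' (P.apply_ne_top z) (Q.apply_ne_top z)).1
      (sub_eq_zero.1 this)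

/-- The trade-off between the delay `A` and the budget `B`, when the inequality with the weight `l`
holds for every `l > 0`. -/
theorem delay_ge_of_forall_weight {d D m A b L δ x : ℝ} (hd : 0 < d) (hD : 0 ≤ D) (hm : 0 ≤ m)
    (hL : 0 < L) (hδ : 0 ≤ δ) (hx : 0 ≤ x) (hb : b ≤ δ * x)
    (h : ∀ l : ℝ, 0 < l → L ≤ d * m + ((d + D * (l / 2)) * A + D * (1 / (2 * l)) * b)) :
    L / d - D * √δ / d ^ (3 / 2 : ℝ) * √x * √L - (m + D / (2 * d ^ 2)) ≤ A := by
  have hgain : 0 ≤ D * √δ / d ^ (3 / 2 : ℝ) * √x * √L := by positivity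
  rcases le_total A (L / d) with hA | hA
  swap
  · have : 0 ≤ m + D / (2 * d ^ 2) := by positivity
    linarith
  have hd32 : d ^ (3 / 2 : ℝ) = d * √d := by
    rw [Real.sqrt_eq_rpow, ← Real.rpow_one_add' hd.le (by norm_num)]
    norm_num
  have hsd : 0 < √d := Real.sqrt_pos.2 hd
  have hsL : 0 < √L := Real.sqrt_pos.2 hL
  -- the optimal weight is `s √d / √L`; the summand `1 / L` keeps it positive when `s = 0`
  set s := √δ * √x with hs
  have hs0 : 0 ≤ s := by positivity
  have hss : s ^ 2 = δ * x := by rw [hs, mul_pow, Real.sq_sqrt hδ, Real.sq_sqrt hx]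
  have hdd : √d ^ 2 = d := Real.sq_sqrt hd.le
  have hLL : √L ^ 2 = L := Real.sq_sqrt hL.le
  set l := s * √d / √L + 1 / L with hl
  have hl0 : 0 < l := by positivity
  have h1 : l * A ≤ s * √L / √d + 1 / d := by
    calc l * A ≤ l * (L / d) := mul_le_mul_of_nonneg_left hA hl0.le
      _ = s * √L / √d + 1 / d := by
        have : (s * √d / √L + 1 / √L ^ 2) * (√L ^ 2 / √d ^ 2) = s * √L / √d + 1 / √d ^ 2 := by
          field_simp
        rwa [hdd, hLL] at this
  have h2 : b / l ≤ s * √L / √d := by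
    rw [div_le_iff₀ hl0]
    have : s * √L / √d * l = s ^ 2 + s * √L / √d / L := by
      rw [hl]
      field_simp
    rw [this, hss]
    have : 0 ≤ s * √L / √d / L := by positivity
    linarith
  have h3 := h l hl0
  have h4 : D * (l * A) ≤ D * (s * √L / √d + 1 / d) := mul_le_mul_of_nonneg_left h1 hD
  have h5 : D * (b / l) ≤ D * (s * √L / √d) := mul_le_mul_of_nonneg_left h2 hD
  have h6 : D * (1 / (2 * l)) * b = D * (b / l) / 2 := by field_simp
  have h7 : L ≤ d * m + d * A + D * (s * √L / √d) + D / (2 * d) := by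
    have : D * (s * √L / √d + 1 / d) / 2 + D * (s * √L / √d) / 2 =
      D * (s * √L / √d) + D / (2 * d) := by field_simp; ring
    rw [h6] at h3
    linarith
  have h8 : L / d - D * √δ / d ^ (3 / 2 : ℝ) * √x * √L - (m + D / (2 * d ^ 2)) =
      (L - d * m - D * (s * √L / √d) - D / (2 * d)) / d := by
    rw [hd32, hs]
    field_simp
    ring
  rw [h8, div_le_iff₀ hd]
  linarith

section bound

variable {Y : Type*} {Z : Type*} [MeasurableSpace Y] [MeasurableSpace Z]
  [Countable Y] [Countable Z] [MeasurableSingletonClass Y] [MeasurableSingletonClass Z]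

/-- An early stop is equally likely under all laws whose changepoint is not before it. -/
theorem pathLaw_stopTime_lt_congr (W : Channel Y Z) (p : Policy Y) {k l n : ℕ} (hk : n ≤ k)
    (hl : n ≤ l) :
    pathLaw W p k {ω | stopTime p ω < n} = pathLaw W p l {ω | stopTime p ω < n} := by
  have hpre : {ω : Path Y Z | stopTime p ω < n} = (fun ω => history ω n) ⁻¹'
      {h | ∃ m : Fin n, p.halt m (fun i => h (Fin.castLE m.2.le i)) = true ∧ (m : ℕ) + 1 < n} := by
    ext ω
    simp only [Set.mem_ofPred_eq, stopTime_lt_iff, Set.mem_preimage]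
    exact ⟨fun ⟨m, hm, hmn⟩ => ⟨⟨m, by omega⟩, hm, hmn⟩, fun ⟨m, hm, hmn⟩ => ⟨m, hm, hmn⟩⟩
  rw [hpre, ← Measure.map_apply (measurable_history n) (Set.to_countable _).measurableSet,
    ← Measure.map_apply (measurable_history n) (Set.to_countable _).measurableSet]
  exact congrArg (fun μ : Measure _ => μ _) (histLaw_congr W p hk hl)

/-- Under the law with changepoint `N`, the false alarm probability bounds the exponential moment
of `min(τ, N)`, because `e^{-ds}` is the prior probability of `s < Γ`. -/
theorem integral_exp_cappedStop_le (W : Channel Y Z) {ρ : ℝ} (hρ0 : 0 < ρ) (hρ1 : ρ < 1)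
    (p : Policy Y) {α : ℝ} (hα : 0 < α) (hPFA : PFA W ρ p ≤ ENNReal.ofReal α) (N : ℕ) :
    ∫ h, Real.exp (-(tailExp ρ * cappedStop p N h)) ∂histLaw W p N N ≤
      α + Real.exp (-(tailExp ρ * N)) := by
  have hpt (ω : Path Y Z) :
      ENNReal.ofReal (Real.exp (-(tailExp ρ * cappedStop p N (history ω N)))) ≤
        (∑' k, ENNReal.ofReal (prior ρ k) *
          {ω | stopTime p ω < ((min k N : ℕ) : ℕ∞)}.indicator 1 ω) +
          ENNReal.ofReal (Real.exp (-(tailExp ρ * N))) := by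
    rcases (cappedStop_le p N (history ω N)).eq_or_lt with hs | hs
    · rw [hs]
      exact le_add_self
    · refine le_add_of_le_left ?_
      rw [exp_neg_tailExp_mul hρ0 hρ1, ← tsum_prior_tail hρ0 hρ1]
      refine ENNReal.tsum_le_tsum fun k => mul_le_mul_right ?_ _
      split_ifs with hk
      · have hmin := cappedStop_history p N ω
        rw [Set.indicator_of_mem]
        · rfl
        · have h1 : (cappedStop p N (history ω N) : ℕ∞) < N := Nat.cast_lt.2 hs
          have h2 : stopTime p ω = cappedStop p N (history ω N) := by
            rw [hmin] at h1 ⊢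
            exact (min_eq_left ((min_lt_iff.1 h1).resolve_right (lt_irrefl _)).le).symm
          simp only [Set.mem_ofPred_eq, h2, Nat.cast_lt]
          exact lt_min hk hs
      · exact zero_le
  have hlint : ∫⁻ ω, ENNReal.ofReal (Real.exp (-(tailExp ρ * cappedStop p N (history ω N))))
      ∂pathLaw W p N ≤ ENNReal.ofReal (α + Real.exp (-(tailExp ρ * N))) := by
    refine (lintegral_mono hpt).trans ?_
    rw [lintegral_add_right _ measurable_const, lintegral_const, measure_univ, mul_one,
      lintegral_tsum fun k => ((measurable_one.indicator
        (measurableSet_stopTime_lt p _)).const_mul _).aemeasurable,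
      ENNReal.ofReal_add hα.le (Real.exp_pos _).le]
    refine add_le_add_left (le_trans ?_ hPFA) _
    rw [PFA_eq]
    refine ENNReal.tsum_le_tsum fun k => ?_
    rw [lintegral_const_mul _ (measurable_one.indicator (measurableSet_stopTime_lt p _)),
      lintegral_indicator_one (measurableSet_stopTime_lt p _),
      pathLaw_stopTime_lt_congr W p (min_le_right k N) (min_le_left k N)]
    refine mul_le_mul_right (measure_mono fun ω hω => ?_) _
    exact lt_of_lt_of_le (Set.mem_ofPred_eq ▸ hω) (Nat.cast_le.2 (min_le_left k N))
  have hpos : 0 ≤ α + Real.exp (-(tailExp ρ * N)) := by positivity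
  rw [integral_eq_lintegral_of_nonneg_ae (Eventually.of_forall fun _ => (Real.exp_pos _).le)
    (measurable_of_countable _).aestronglyMeasurable]
  refine ENNReal.toReal_le_of_le_ofReal hpos ?_
  rw [histLaw, lintegral_map (measurable_of_countable _) (by fun_prop)]
  exact hlint

/-- The non-asymptotic converse for a fixed changepoint `k` and horizon `N`. -/
theorem ofReal_neg_log_le_of_horizon (W : Channel Y Z) {ρ : ℝ} (hρ0 : 0 < ρ) (hρ1 : ρ < 1)
    (hP : aliceChannel W false true = aliceChannel W false false) (hDtop : activeDiv W < ∞)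
    (p : Policy Y) {α : ℝ} (hα : 0 < α) (hPFA : PFA W ρ p ≤ ENNReal.ofReal α) {l : ℝ}
    (hl : 0 < l) (k N : ℕ) :
    ENNReal.ofReal (-Real.log (α + Real.exp (-(tailExp ρ * N)))) ≤
      ∫⁻ ω, (ENNReal.ofReal (tailExp ρ) * k +
        (ENNReal.ofReal (tailExp ρ + (activeDiv W).toReal * (l / 2)) *
          ((stopTime p ω - (k : ℕ∞) : ℕ∞) : ℝ≥0∞) +
        ENNReal.ofReal ((activeDiv W).toReal * (1 / (2 * l))) * postBudget p k ω))
        ∂pathLaw W p k := by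
  have hd := tailExp_pos hρ0 hρ1
  set D := (activeDiv W).toReal with hD
  have hD0 : 0 ≤ D := ENNReal.toReal_nonneg
  set G : Path Y Z → ℝ := fun ω => tailExp ρ * cappedStop p N (history ω N) +
    D * ∑ i ∈ Finset.range N, if k ≤ i then p.probe i (history ω i) else 0 with hG
  have hβ (i) (ω : Path Y Z) := p.probe_mem i (history ω i)
  have hI1 : Integrable (fun ω => tailExp ρ * cappedStop p N (history ω N)) (pathLaw W p k) :=
    integrable_of_forall_abs_le ((measurable_of_countable fun h : Fin N → Bool × Y =>
      tailExp ρ * (cappedStop p N h : ℝ)).comp (measurable_history N)) fun ω =>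
        abs_tailExp_mul_cappedStop_le hρ0 hρ1 p N _
  have hIβ (i) : Integrable (fun ω : Path Y Z => if k ≤ i then p.probe i (history ω i) else 0)
      (pathLaw W p k) := by
    split_ifs
    · exact integrable_of_forall_abs_le (M := 1) (measurable_probe p i) fun ω => by
        rw [abs_of_nonneg (hβ i ω).1]
        exact (hβ i ω).2
    · exact integrable_zero _ _ _
  have hI2 : Integrable (fun ω => D * ∑ i ∈ Finset.range N,
      if k ≤ i then p.probe i (history ω i) else 0) (pathLaw W p k) :=
    (integrable_finsetSum _ fun i _ => hIβ i).const_mul D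
  have hlog : -Real.log (α + Real.exp (-(tailExp ρ * N))) ≤ ∫ ω, G ω ∂pathLaw W p k := by
    have hDV := neg_log_integral_histLaw_le W hP hDtop p k N le_rfl
      (abs_tailExp_mul_cappedStop_le hρ0 hρ1 p N)
    have hle := integral_exp_cappedStop_le W hρ0 hρ1 p hα hPFA N
    have hpos : 0 < ∫ h, Real.exp (-(tailExp ρ * cappedStop p N h)) ∂histLaw W p N N := by
      refine integral_exp_pos (integrable_of_forall_abs_le (M := Real.exp (tailExp ρ * N))
        (measurable_of_countable _) fun h => ?_)
      rw [Real.abs_exp]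
      exact Real.exp_le_exp.2
        ((neg_le_abs _).trans (abs_tailExp_mul_cappedStop_le hρ0 hρ1 p N h))
    refine (neg_le_neg (Real.log_le_log hpos hle)).trans (hDV.trans_eq ?_)
    rw [hG, integral_add hI1 hI2, integral_const_mul D, integral_finsetSum _ fun i _ => hIβ i,
      histLaw, integral_map (by fun_prop) (measurable_of_countable _).aestronglyMeasurable]
    congr 2
    refine Finset.sum_congr rfl fun i _ => ?_
    split_ifs
    · rw [histLaw, integral_map (by fun_prop) (measurable_of_countable _).aestronglyMeasurable]
    · simp
  have hsum (ω : Path Y Z) :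
      0 ≤ ∑ i ∈ Finset.range N, if k ≤ i then p.probe i (history ω i) else 0 :=
    Finset.sum_nonneg fun i _ => by split_ifs <;> simp [(hβ i ω).1]
  have hG0 (ω) : 0 ≤ G ω := add_nonneg (by positivity) (mul_nonneg hD0 (hsum ω))
  refine (ENNReal.ofReal_le_ofReal hlog).trans ?_
  rw [ofReal_integral_eq_lintegral_ofReal (f := G) (hI1.add hI2) (Eventually.of_forall hG0)]
  refine lintegral_mono fun ω => ?_
  have hcap : (cappedStop p N (history ω N) : ℝ≥0∞) ≤
      k + ((stopTime p ω - (k : ℕ∞) : ℕ∞) : ℝ≥0∞) := by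
    have h1 : (cappedStop p N (history ω N) : ℕ∞) ≤ k + (stopTime p ω - (k : ℕ∞)) := by
      rw [cappedStop_history]
      exact (min_le_left _ _).trans le_add_tsub
    have h2 := ENat.toENNReal_le.2 h1
    rwa [ENat.toENNReal_add, ENat.toENNReal_coe, ENat.toENNReal_coe] at h2
  calc ENNReal.ofReal (G ω)
      = ENNReal.ofReal (tailExp ρ) * (cappedStop p N (history ω N) : ℝ≥0∞) +
          ENNReal.ofReal D * ENNReal.ofReal
            (∑ i ∈ Finset.range N, if k ≤ i then p.probe i (history ω i) else 0) := by
        rw [hG, ENNReal.ofReal_add (by positivity) (mul_nonneg hD0 (hsum ω)),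
          ENNReal.ofReal_mul hd.le, ENNReal.ofReal_mul hD0, ENNReal.ofReal_natCast]
    _ ≤ ENNReal.ofReal (tailExp ρ) * (k + ((stopTime p ω - (k : ℕ∞) : ℕ∞) : ℝ≥0∞)) +
          ENNReal.ofReal D * (ENNReal.ofReal (l / 2) *
            ((stopTime p ω - (k : ℕ∞) : ℕ∞) : ℝ≥0∞) +
              ENNReal.ofReal (1 / (2 * l)) * postBudget p k ω) := by
        gcongr
        exact sum_probe_le p ω k N hl
    _ = _ := by
        rw [ENNReal.ofReal_add hd.le (by positivity), ENNReal.ofReal_mul hD0,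
          ENNReal.ofReal_mul hD0]
        ring

theorem ofReal_neg_log_le (W : Channel Y Z) {ρ : ℝ} (hρ0 : 0 < ρ) (hρ1 : ρ < 1)
    (hP : aliceChannel W false true = aliceChannel W false false) (hDtop : activeDiv W < ∞)
    (p : Policy Y) {α : ℝ} (hα : 0 < α) (hPFA : PFA W ρ p ≤ ENNReal.ofReal α) {l : ℝ}
    (hl : 0 < l) :
    ENNReal.ofReal (-Real.log α) ≤
      ENNReal.ofReal (tailExp ρ) * ∑' k, ENNReal.ofReal (prior ρ k) * (k : ℝ≥0∞) +
        (ENNReal.ofReal (tailExp ρ + (activeDiv W).toReal * (l / 2)) * ADD W ρ p +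
        ENNReal.ofReal ((activeDiv W).toReal * (1 / (2 * l))) *
          ∑' k, ENNReal.ofReal (prior ρ k) * ∫⁻ ω, postBudget p k ω ∂pathLaw W p k) := by
  have hlim : Tendsto (fun N : ℕ => ENNReal.ofReal
      (-Real.log (α + Real.exp (-(tailExp ρ * N))))) atTop (𝓝 (ENNReal.ofReal (-Real.log α))) := by
    have h1 : Tendsto (fun N : ℕ => α + Real.exp (-(tailExp ρ * N))) atTop (𝓝 (α + 0)) :=
      tendsto_const_nhds.add (Real.tendsto_exp_neg_atTop_nhds_zero.comp
        (tendsto_natCast_atTop_atTop.const_mul_atTop (tailExp_pos hρ0 hρ1)))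
    rw [add_zero] at h1
    exact (ENNReal.continuous_ofReal.tendsto _).comp ((h1.log hα.ne').neg)
  have hk (k : ℕ) := le_of_tendsto' hlim fun N =>
    ofReal_neg_log_le_of_horizon W hρ0 hρ1 hP hDtop p hα hPFA hl k N
  have hmix := ENNReal.tsum_le_tsum fun k =>
    mul_le_mul_right (hk k) (ENNReal.ofReal (prior ρ k))
  rw [ENNReal.tsum_mul_right, tsum_prior hρ0 hρ1, one_mul] at hmix
  refine hmix.trans_eq ?_
  rw [ADD_eq, ← ENNReal.tsum_mul_left, ← ENNReal.tsum_mul_left, ← ENNReal.tsum_mul_left,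
    ← ENNReal.summable.tsum_add ENNReal.summable, ← ENNReal.summable.tsum_add ENNReal.summable]
  refine tsum_congr fun k => ?_
  rw [lintegral_add_left measurable_const, lintegral_const, measure_univ, mul_one,
    lintegral_add_left ((measurable_delay p k).const_mul _),
    lintegral_const_mul _ (measurable_delay p k),
    lintegral_const_mul _ (measurable_postBudget p k)]
  ring

/-- The second-order lower bound, valid for every `α < 1`. -/
theorem le_ADD (W : Channel Y Z) {ρ : ℝ} (hρ0 : 0 < ρ) (hρ1 : ρ < 1)
    (hQac : ∀ z, eveChannel W false true z = 0 → eveChannel W true true z = 0)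
    (hQne : eveChannel W true true ≠ eveChannel W false true)
    (hP : aliceChannel W false true = aliceChannel W false false) (hDtop : activeDiv W < ∞)
    {δ : ℝ} (hδ : 0 < δ) (p : Policy Y) {α : ℝ} (hα0 : 0 < α) (hα1 : α < 1)
    (hPFA : PFA W ρ p ≤ ENNReal.ofReal α) (hECB : ECB W ρ p ≤ ENNReal.ofReal δ) :
    ENNReal.ofReal (|Real.log α| / tailExp ρ - gainCoeff W ρ δ * √|Real.log α| -
      ((∑' k, ENNReal.ofReal (prior ρ k) * (k : ℝ≥0∞)).toReal +
        (activeDiv W).toReal / (2 * tailExp ρ ^ 2))) ≤ ADD W ρ p := by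
  by_cases hA : ADD W ρ p = ∞
  · simp [hA]
  have hχ : eveChi2 W true ≠ 0 := chi2_ne_zero hQac hQne
  have hlog : Real.log α < 0 := Real.log_neg hα0 hα1
  have hm := tsum_prior_mul_ne_top hρ0 hρ1
  set B := ∑' k, ENNReal.ofReal (prior ρ k) * ∫⁻ ω, postBudget p k ω ∂pathLaw W p k with hB
  set m := ∑' k, ENNReal.ofReal (prior ρ k) * (k : ℝ≥0∞) with hmdef
  have hBle : B ≤ ENNReal.ofReal δ * (eveChi2 W true)⁻¹ := by
    have h := (le_ECB W ρ p).trans hECB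
    rw [← div_eq_mul_inv, ENNReal.le_div_iff_mul_le (Or.inl hχ) (Or.inr ENNReal.ofReal_ne_top),
      mul_comm]
    exact h
  have hfin : ENNReal.ofReal δ * (eveChi2 W true)⁻¹ ≠ ∞ :=
    ENNReal.mul_ne_top ENNReal.ofReal_ne_top (ENNReal.inv_ne_top.2 hχ)
  have hBtop : B ≠ ∞ := ne_top_of_le_ne_top hfin hBle
  have hBreal : B.toReal ≤ δ * (eveChi2 W true)⁻¹.toReal := by
    have := ENNReal.toReal_mono hfin hBle
    rwa [ENNReal.toReal_mul, ENNReal.toReal_ofReal hδ.le] at this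
  rw [← ENNReal.ofReal_toReal hA]
  refine ENNReal.ofReal_le_ofReal ?_
  have hd := tailExp_pos hρ0 hρ1
  refine delay_ge_of_forall_weight hd ENNReal.toReal_nonneg ENNReal.toReal_nonneg
    (abs_pos.2 hlog.ne) hδ.le ENNReal.toReal_nonneg hBreal fun l hl => ?_
  have h := ofReal_neg_log_le W hρ0 hρ1 hP hDtop p hα0 hPFA hl
  rw [← hB, ← hmdef, ← ENNReal.ofReal_toReal hA, ← ENNReal.ofReal_toReal hm,
    ← ENNReal.ofReal_toReal hBtop] at h
  have hc : 0 ≤ tailExp ρ + (activeDiv W).toReal * (l / 2) := by positivity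
  have hc' : 0 ≤ (activeDiv W).toReal * (1 / (2 * l)) := by positivity
  rw [← ENNReal.ofReal_mul hd.le, ← ENNReal.ofReal_mul hc, ← ENNReal.ofReal_mul hc',
    ← ENNReal.ofReal_add (by positivity) (by positivity),
    ← ENNReal.ofReal_add (by positivity) (by positivity),
    ENNReal.ofReal_le_ofReal_iff (by positivity)] at h
  rwa [abs_of_neg hlog]

end bound

/-! ### Deterministic stopping -/

/-- The innocent policy that stops at the deterministic time `n + 2`. -/
def waitPolicy (Y : Type*) (n : ℕ) : Policy Y where
  probe _ _ := 0
  halt j _ := decide (j = n + 1)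
  probe_mem _ _ := by simp
  halt_zero _ := by simp
  probe_eq_zero _ _ _ := rfl

theorem stopTime_waitPolicy {Y : Type*} {Z : Type*} (n : ℕ) (ω : Path Y Z) :
    stopTime (waitPolicy Y n) ω = ((n + 2 : ℕ) : ℕ∞) := by
  simp [stopTime, waitPolicy, add_assoc, one_add_one_eq_two]

section wait

variable {Y : Type*} {Z : Type*} [MeasurableSpace Y] [MeasurableSpace Z]
  [Countable Y] [Countable Z] [MeasurableSingletonClass Y] [MeasurableSingletonClass Z]

theorem PFA_waitPolicy (W : Channel Y Z) {ρ : ℝ} (hρ0 : 0 < ρ) (hρ1 : ρ < 1) (n : ℕ) :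
    PFA W ρ (waitPolicy Y n) = ENNReal.ofReal ((1 - ρ) ^ (n + 2)) := by
  rw [PFA_eq, ← tsum_prior_tail hρ0 hρ1]
  refine tsum_congr fun k => ?_
  simp only [stopTime_waitPolicy, Nat.cast_lt]
  split_ifs with h <;> simp [h]

theorem ECB_waitPolicy (W : Channel Y Z) (ρ : ℝ) (n : ℕ) : ECB W ρ (waitPolicy Y n) = 0 := by
  simp [ECB, waitPolicy]

theorem ADD_waitPolicy_le (W : Channel Y Z) {ρ : ℝ} (hρ0 : 0 < ρ) (hρ1 : ρ < 1) (n : ℕ) :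
    ADD W ρ (waitPolicy Y n) ≤ ((n + 2 : ℕ) : ℝ≥0∞) := by
  rw [ADD_eq]
  calc _ ≤ ∑' k, ENNReal.ofReal (prior ρ k) * ((n + 2 : ℕ) : ℝ≥0∞) := by
        refine ENNReal.tsum_le_tsum fun k => mul_le_mul_right ?_ _
        refine (lintegral_mono (g := fun _ => ((n + 2 : ℕ) : ℝ≥0∞)) fun ω => ?_).trans (by simp)
        rw [stopTime_waitPolicy, ← ENat.toENNReal_coe]
        exact ENat.toENNReal_le.2 tsub_le_self
    _ = _ := by rw [ENNReal.tsum_mul_right, tsum_prior hρ0 hρ1, one_mul]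

/-- Waiting until `|ln α| / d` meets the false alarm constraint. -/
theorem exists_waitPolicy (W : Channel Y Z) {ρ : ℝ} (hρ0 : 0 < ρ) (hρ1 : ρ < 1) {α : ℝ}
    (hα0 : 0 < α) (hα1 : α < 1) :
    ∃ n : ℕ, PFA W ρ (waitPolicy Y n) ≤ ENNReal.ofReal α ∧
      ADD W ρ (waitPolicy Y n) ≤ ENNReal.ofReal (|Real.log α| / tailExp ρ + 3) := by
  have hd := tailExp_pos hρ0 hρ1
  have hL : |Real.log α| = -Real.log α := abs_of_neg (Real.log_neg hα0 hα1)
  have hx : 0 ≤ |Real.log α| / tailExp ρ := by positivity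
  refine ⟨⌈|Real.log α| / tailExp ρ⌉₊, ?_, ?_⟩
  · rw [PFA_waitPolicy W hρ0 hρ1, ← exp_neg_tailExp_mul hρ0 hρ1]
    refine ENNReal.ofReal_le_ofReal ?_
    rw [← Real.le_log_iff_exp_le hα0, neg_le, ← hL, ← div_le_iff₀' hd]
    push_cast
    linarith [Nat.le_ceil (|Real.log α| / tailExp ρ)]
  · refine (ADD_waitPolicy_le W hρ0 hρ1 _).trans ?_
    rw [← ENNReal.ofReal_natCast]
    refine ENNReal.ofReal_le_ofReal ?_
    push_cast
    linarith [Nat.ceil_lt_add_one hx]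

end wait

end CovertQCD

open CovertQCD
theorem mainTheorem1 {Y : Type*} {Z : Type*} [MeasurableSpace Y] [MeasurableSpace Z]
    [Countable Y] [Countable Z] [MeasurableSingletonClass Y] [MeasurableSingletonClass Z]
    (W : Channel Y Z) (ρ : ℝ) (hρ0 : 0 < ρ) (hρ1 : ρ < 1)
    -- `Q^1_θ ≪ Q^0_θ` and `Q^1_θ ≠ Q^0_θ`
    (hQac : ∀ θ z, eveChannel W false θ z = 0 → eveChannel W true θ z = 0)
    (hQne : ∀ θ, eveChannel W true θ ≠ eveChannel W false θ)
    -- no free passive sensing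
    (hP : aliceChannel W false true = aliceChannel W false false)
    -- active sensing has non-zero but finite gain: `0 < D < ∞` and `V < ∞`
    (hD0 : 0 < activeDiv W) (hDtop : activeDiv W < ∞)
    (hV : llrSecondMoment (aliceChannel W true true) (aliceChannel W true false) < ∞)
    (δ : ℝ) (hδ : 0 < δ) :
    -- the second-order lower bound, uniformly over all policies that meet the constraints
    (∃ C : ℝ, ∀ᶠ α in 𝓝[>] (0 : ℝ), ∀ p : Policy Y,
      PFA W ρ p ≤ ENNReal.ofReal α → ECB W ρ p ≤ ENNReal.ofReal δ →
        ((|Real.log α| / tailExp ρ - gainCoeff W ρ δ * √|Real.log α| - C : ℝ) : EReal)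
          ≤ (ADD W ρ p : EReal)) ∧
    -- the first-order delay is that of passive waiting
    Tendsto (fun α : ℝ => minADD W ρ α δ / ENNReal.ofReal |Real.log α|) (𝓝[>] 0)
      (𝓝 (ENNReal.ofReal (1 / tailExp ρ))) ∧
    -- the gain over innocent policies is at most of square-root order
    (∃ C : ℝ, ∀ᶠ α in 𝓝[>] (0 : ℝ),
      minInnocentADD W ρ α
        ≤ minADD W ρ α δ + ENNReal.ofReal (gainCoeff W ρ δ * √|Real.log α| + C)) := by
  obtain ⟨C, hC⟩ : ∃ C : ℝ, ∀ α : ℝ, 0 < α → α < 1 → ∀ p : Policy Y,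
      PFA W ρ p ≤ ENNReal.ofReal α → ECB W ρ p ≤ ENNReal.ofReal δ →
        ENNReal.ofReal (|Real.log α| / tailExp ρ - gainCoeff W ρ δ * √|Real.log α| - C) ≤
          ADD W ρ p :=
    ⟨_, fun α hα0 hα1 p => le_ADD W hρ0 hρ1 (hQac true) (hQne true) hP hDtop hδ p
      hα0 hα1⟩
  have hmem : ∀ᶠ α : ℝ in 𝓝[>] 0, 0 < α ∧ α < 1 := by
    filter_upwards [Ioo_mem_nhdsGT (zero_lt_one' ℝ)] with α hα using hα
  have hlower (α : ℝ) (hα0 : 0 < α) (hα1 : α < 1) :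
      ENNReal.ofReal (|Real.log α| / tailExp ρ - gainCoeff W ρ δ * √|Real.log α| - C) ≤
        minADD W ρ α δ :=
    le_iInf₂ fun p hp => hC α hα0 hα1 p hp.1 hp.2
  have hlogtop : Tendsto (fun α : ℝ => |Real.log α|) (𝓝[>] 0) atTop :=
    tendsto_abs_atBot_atTop.comp Real.tendsto_log_nhdsGT_zero
  refine ⟨⟨C, ?_⟩, ?_, ⟨C + 3, ?_⟩⟩
  · filter_upwards [hmem] with α hα p hPFA hECB
    refine le_trans ?_ (EReal.coe_ennreal_le_coe_ennreal_iff.2 (hC α hα.1 hα.2 p hPFA hECB))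
    rw [EReal.coe_ennreal_ofReal]
    exact EReal.coe_le_coe_iff.2 (le_max_left _ _)
  · have hup : Tendsto (fun α : ℝ => ENNReal.ofReal (1 / tailExp ρ + 3 / |Real.log α|)) (𝓝[>] 0)
        (𝓝 (ENNReal.ofReal (1 / tailExp ρ))) := by
      refine ENNReal.tendsto_ofReal ?_
      simpa using tendsto_const_nhds.add (hlogtop.const_div_atTop 3)
    have hlo : Tendsto (fun α : ℝ => ENNReal.ofReal (1 / tailExp ρ -
        gainCoeff W ρ δ / √|Real.log α| - C / |Real.log α|)) (𝓝[>] 0)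
        (𝓝 (ENNReal.ofReal (1 / tailExp ρ))) := by
      refine ENNReal.tendsto_ofReal ?_
      have hsqrt := Real.tendsto_sqrt_atTop.comp hlogtop
      simpa using (tendsto_const_nhds.sub (hsqrt.const_div_atTop (gainCoeff W ρ δ))).sub
        (hlogtop.const_div_atTop C)
    refine tendsto_of_tendsto_of_tendsto_of_le_of_le' hlo hup ?_ ?_
    · filter_upwards [hmem] with α hα
      have hL : 0 < |Real.log α| := abs_pos.2 (Real.log_neg hα.1 hα.2).ne
      refine le_trans (le_of_eq ?_) (ENNReal.div_le_div_right (hlower α hα.1 hα.2) _)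
      rw [← ENNReal.ofReal_div_of_pos hL]
      congr 1
      have hs : √|Real.log α| / |Real.log α| = 1 / √|Real.log α| := Real.sqrt_div_self'
      rw [sub_div, sub_div, mul_div_assoc, hs, div_right_comm, div_self hL.ne', mul_one_div]
    · filter_upwards [hmem] with α hα
      have hL : 0 < |Real.log α| := abs_pos.2 (Real.log_neg hα.1 hα.2).ne
      obtain ⟨n, hn1, hn2⟩ := exists_waitPolicy W hρ0 hρ1 hα.1 hα.2
      have hmin : minADD W ρ α δ ≤ ADD W ρ (waitPolicy Y n) :=
        iInf₂_le (waitPolicy Y n) ⟨hn1, by simp [ECB_waitPolicy]⟩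
      refine (ENNReal.div_le_div_right (hmin.trans hn2) _).trans (le_of_eq ?_)
      rw [← ENNReal.ofReal_div_of_pos hL]
      congr 1
      field_simp
  · filter_upwards [hmem] with α hα
    obtain ⟨n, hn1, hn2⟩ := exists_waitPolicy W hρ0 hρ1 hα.1 hα.2
    have hinn : minInnocentADD W ρ α ≤ ADD W ρ (waitPolicy Y n) :=
      iInf₂_le (waitPolicy Y n) ⟨fun _ _ => rfl, hn1⟩
    refine (hinn.trans hn2).trans ?_
    refine le_trans ?_ (add_le_add_left (hlower α hα.1 hα.2) _)
    refine le_trans (ENNReal.ofReal_le_ofReal (le_of_eq ?_)) ENNReal.ofReal_add_le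
    ring
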